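/- Let $D$ be the open unit disk in $\mathbb{C}$ and let $J=\{e^{it}: 0<t<1\}$. Let $p\in\{1,2,\dots\}\cup\{\infty\}$, let $f: D\cup J\to\mathbb{C}$ be continuous on $D\cup J$ and holomorphic in $D$, and define $g:(0,1)\to\mathbb{C}$ by $g(t)=f(e^{it})$. Then the following are equivalent: 1. for every integer $l$ with $0\le l\le p$ (every integer $l\ge 0$ if $p=\infty$), the derivative $f^{(l)}$, defined on $D$, extends continuously to $D\cup J$; 2. $g\in C^p((0,1))$. In that case, denoting the continuous extension of $f'$ to $D\cup J$ again by $f'$, for all $t\in(0,1)$ $$\frac{dg}{dt}(t)= i e^{it} f'(e^{it}).$$ -/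

import Mathlib

open Set

/-- The open arc `{e^{it} : 0 < t < 1}` of the unit circle. -/
def openArc : Set ℂ := {z | ∃ t : ℝ, 0 < t ∧ t < 1 ∧ z = Complex.exp (Complex.I * t)}

/-- The set `D ∪ {e^{it} : 0 < t < 1}`, where `D` is the open unit disk. -/
def diskWithArc : Set ℂ := Metric.ball (0 : ℂ) 1 ∪ openArc

/-- `F` is a continuous extension to `D ∪ {e^{it} : 0 < t < 1}` of the restriction of `h` to the
open unit disk `D`. Only the values of `h` on `D` and of `F` on `D ∪ {e^{it} : 0 < t < 1}`
matter. -/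
def IsContExtension (h F : ℂ → ℂ) : Prop :=
  ContinuousOn F diskWithArc ∧ EqOn F h (Metric.ball (0 : ℂ) 1)

section
open Filter Topology Metric

/-! If `f'` extends continuously, then `f` has a real Fréchet derivative up to the arc. The chain
rule along `t ↦ e^{it}` gives `g' = i e^{it} f'(e^{it})` (`hasDerivAt_boundary`), and induction
gives `C^n`.

The converse reduces to `n = 1`: then `g' / (i e^{it})` is the boundary function of the extended
`f'`, and the argument repeats. For `g` of class `C¹`, the quotients `(f(e^{iε} z) - f(z)) / ε` are
holomorphic in `D`. As `ε → 0` they tend to `i z f'(z)` in `D` and to `g'` on the arc, locally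
uniformly in each. The maximum principle on a lens `ball z₀ δ ∩ D` should carry this convergence up
to the arc, but at the two corners the quotients are only bounded by a multiple of `1 / (1 - ‖z‖)`.
A squared polynomial weight, of size `(δ (1 - ‖z‖²))²` on the inner boundary and nonzero at `z₀`,
absorbs this growth (`norm_weight_sq_mul_rotationQuotient_le`). The weighted quotients are then
uniformly Cauchy on the closed lens, so `f'` has a limit at `z₀`. -/

/-! ### Geometry of the arc -/

theorem norm_exp_I_mul (t : ℝ) : ‖Complex.exp (Complex.I * t)‖ = 1 :=
  Complex.norm_exp_I_mul_ofReal t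

theorem exp_I_mul_mem_openArc {t : ℝ} (ht : t ∈ Ioo (0 : ℝ) 1) :
    Complex.exp (Complex.I * t) ∈ openArc := ⟨t, ht.1, ht.2, rfl⟩

theorem exp_I_mul_mem_diskWithArc {t : ℝ} (ht : t ∈ Ioo (0 : ℝ) 1) :
    Complex.exp (Complex.I * t) ∈ diskWithArc := Or.inr (exp_I_mul_mem_openArc ht)

theorem arg_exp_I_mul {t : ℝ} (ht : t ∈ Ioo (0 : ℝ) 1) :
    (Complex.exp (Complex.I * t)).arg = t := by
  have hpi := Real.pi_gt_three
  rw [mul_comm, Complex.exp_mul_I]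
  exact Complex.arg_cos_add_sin_mul_I ⟨by linarith [ht.1], by linarith [ht.2]⟩

theorem exp_I_mul_arg {z : ℂ} (hz : ‖z‖ = 1) : Complex.exp (Complex.I * z.arg) = z := by
  have h := Complex.norm_mul_exp_arg_mul_I z
  rwa [hz, Complex.ofReal_one, one_mul, mul_comm] at h

theorem continuousAt_arg_exp_I_mul {t : ℝ} (ht : t ∈ Ioo (0 : ℝ) 1) :
    ContinuousAt Complex.arg (Complex.exp (Complex.I * t)) := by
  have hpi := Real.pi_gt_three
  refine Complex.continuousAt_arg (Complex.mem_slitPlane_iff_arg.2 ⟨?_, Complex.exp_ne_zero _⟩)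
  rw [arg_exp_I_mul ht]
  linarith [ht.2]

theorem eventually_arg_mem {t : ℝ} (ht : t ∈ Ioo (0 : ℝ) 1) :
    ∀ᶠ z in 𝓝 (Complex.exp (Complex.I * t)), Complex.arg z ∈ Ioo (0 : ℝ) 1 := by
  refine (continuousAt_arg_exp_I_mul ht).eventually ?_
  rw [arg_exp_I_mul ht]
  exact isOpen_Ioo.mem_nhds ht

/-- Near a point of the open arc, the closed disk is contained in `diskWithArc`. -/
theorem exists_ball_inter_closedBall_subset {t : ℝ} (ht : t ∈ Ioo (0 : ℝ) 1) :
    ∃ r > 0, closedBall (Complex.exp (Complex.I * t)) r ∩ closedBall 0 1 ⊆ diskWithArc := by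
  obtain ⟨r, hr, h⟩ := nhds_basis_closedBall.eventually_iff.1 (eventually_arg_mem ht)
  refine ⟨r, hr, fun z hz => ?_⟩
  rcases (mem_closedBall_zero_iff.1 hz.2).lt_or_eq with h1 | h1
  · exact Or.inl (mem_ball_zero_iff.2 h1)
  · rw [← exp_I_mul_arg h1]
    exact exp_I_mul_mem_diskWithArc (h hz.1)

theorem diskWithArc_subset_closedBall : diskWithArc ⊆ closedBall 0 1 := by
  rintro z (hz | ⟨t, -, -, rfl⟩)
  · exact ball_subset_closedBall hz
  · simp

theorem diskWithArc_subset_closure : diskWithArc ⊆ closure (ball (0 : ℂ) 1) := by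
  rw [closure_ball _ one_ne_zero]
  exact diskWithArc_subset_closedBall

theorem hasDerivAt_exp_I_mul (t : ℝ) :
    HasDerivAt (fun s : ℝ => Complex.exp (Complex.I * s))
      (Complex.I * Complex.exp (Complex.I * t)) t := by
  have h := ((Complex.ofRealCLM.hasDerivAt (x := t)).const_mul Complex.I).cexp
  simp only [Complex.ofRealCLM_apply, Complex.ofReal_one, mul_one] at h
  rwa [mul_comm] at h

/-! ### From extended derivatives to smoothness on the arc -/

/-- If `f'` extends continuously to the arc, then the boundary function is differentiable with the
derivative predicted by the chain rule. -/
theorem hasDerivAt_boundary {f F : ℂ → ℂ} (hcont : ContinuousOn f diskWithArc)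
    (hhol : DifferentiableOn ℂ f (ball (0 : ℂ) 1)) (hF : IsContExtension (deriv f) F)
    {t : ℝ} (ht : t ∈ Ioo (0 : ℝ) 1) :
    HasDerivAt (fun s : ℝ => f (Complex.exp (Complex.I * s)))
      (Complex.I * Complex.exp (Complex.I * t) * F (Complex.exp (Complex.I * t))) t := by
  obtain ⟨r, hr, hsub⟩ := exists_ball_inter_closedBall_subset ht
  set z₀ := Complex.exp (Complex.I * t) with hz₀
  set s := ball z₀ r ∩ ball (0 : ℂ) 1 with hs
  have hclos : closure s ⊆ diskWithArc :=
    (closure_minimal (inter_subset_inter ball_subset_closedBall ball_subset_closedBall)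
      (isClosed_closedBall.inter isClosed_closedBall)).trans hsub
  have hsD : s ⊆ diskWithArc := subset_closure.trans hclos
  have hopen : IsOpen s := isOpen_ball.inter isOpen_ball
  -- The lens is convex, so a limit of the derivatives at a boundary point is the derivative there
  -- relative to the closure. Scalars are real so that a real curve can be composed with it.
  have key : HasFDerivWithinAt f
      ((ContinuousLinearMap.toSpanSingleton ℂ (F z₀)).restrictScalars ℝ) (closure s) z₀ := by
    refine hasFDerivWithinAt_closure_of_tendsto_fderiv
      ((hhol.mono inter_subset_right).restrictScalars ℝ)
      ((convex_ball _ _).inter (convex_ball _ _)) hopen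
      (fun y hy => (hcont y (hclos hy)).mono hsD) ?_
    have h1 : Tendsto (fun y => (ContinuousLinearMap.toSpanSingleton ℂ (F y)).restrictScalars ℝ)
        (𝓝[s] z₀) (𝓝 ((ContinuousLinearMap.toSpanSingleton ℂ (F z₀)).restrictScalars ℝ)) := by
      have hc : Continuous fun c : ℂ =>
          (ContinuousLinearMap.toSpanSingleton ℂ c).restrictScalars ℝ :=
        (ContinuousLinearMap.restrictScalarsL ℂ ℂ ℂ ℝ ℝ).continuous.comp
          (ContinuousLinearMap.toSpanSingletonCLE (𝕜 := ℂ) (E := ℂ)).continuous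
      exact (hc.tendsto _).comp
        ((hF.1 z₀ (exp_I_mul_mem_diskWithArc ht)).mono hsD)
    refine h1.congr' ?_
    filter_upwards [self_mem_nhdsWithin] with y hy
    have hd : HasDerivAt f (deriv f y) y :=
      (hhol.differentiableAt (isOpen_ball.mem_nhds hy.2)).hasDerivAt
    rw [hF.2 hy.2]
    exact (hd.hasFDerivAt.restrictScalars ℝ).fderiv.symm
  have hmaps : ∀ᶠ u : ℝ in 𝓝 t, Complex.exp (Complex.I * u) ∈ closure s := by
    have hev : ∀ᶠ u : ℝ in 𝓝 t, Complex.exp (Complex.I * u) ∈ ball z₀ r :=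
      (hasDerivAt_exp_I_mul t).continuousAt.eventually (ball_mem_nhds _ hr)
    filter_upwards [hev] with u hu
    refine isOpen_ball.inter_closure ⟨hu, ?_⟩
    rw [closure_ball _ one_ne_zero]
    simp
  have h := key.comp_hasDerivAt t (hasDerivAt_exp_I_mul t) hmaps
  simpa [Function.comp_def] using h

theorem IsContExtension.differentiableOn {f F : ℂ → ℂ} (hF : IsContExtension (deriv f) F)
    (hhol : DifferentiableOn ℂ f (ball (0 : ℂ) 1)) : DifferentiableOn ℂ F (ball (0 : ℂ) 1) :=
  (hhol.deriv isOpen_ball).congr hF.2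

theorem IsContExtension.iteratedDeriv_succ_eqOn {f F : ℂ → ℂ}
    (hF : IsContExtension (deriv f) F) (n : ℕ) :
    EqOn (iteratedDeriv n F) (iteratedDeriv (n + 1) f) (ball (0 : ℂ) 1) := by
  intro z hz
  rw [iteratedDeriv_succ']
  exact Filter.EventuallyEq.iteratedDeriv_eq n
    (hF.2.eventuallyEq_of_mem (isOpen_ball.mem_nhds hz))

theorem contDiffOn_boundary {n : ℕ} : ∀ {f : ℂ → ℂ}, ContinuousOn f diskWithArc →
    DifferentiableOn ℂ f (ball (0 : ℂ) 1) →
    (∀ l ≤ n, ∃ F : ℂ → ℂ, IsContExtension (iteratedDeriv l f) F) →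
    ContDiffOn ℝ n (fun t : ℝ => f (Complex.exp (Complex.I * t))) (Ioo (0 : ℝ) 1) := by
  induction n with
  | zero =>
    intro f hcont _ _
    refine contDiffOn_zero.2 (hcont.comp ?_ fun t ht => exp_I_mul_mem_diskWithArc ht)
    exact fun t _ => (hasDerivAt_exp_I_mul t).continuousAt.continuousWithinAt
  | succ n ih =>
    intro f hcont hhol hext
    obtain ⟨F, hF⟩ := hext 1 (by omega)
    rw [iteratedDeriv_one] at hF
    have hC := ih hF.1 (hF.differentiableOn hhol) fun l hl => by
      obtain ⟨G, hG⟩ := hext (l + 1) (by omega)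
      exact ⟨G, hG.1, hG.2.trans (hF.iteratedDeriv_succ_eqOn l).symm⟩
    have hd := fun t (ht : t ∈ Ioo (0 : ℝ) 1) => hasDerivAt_boundary hcont hhol hF ht
    push_cast
    refine (contDiffOn_succ_iff_deriv_of_isOpen isOpen_Ioo).2
      ⟨fun t ht => (hd t ht).differentiableAt.differentiableWithinAt, by simp, ?_⟩
    have hexp : ContDiff ℝ n fun t : ℝ => Complex.exp (Complex.I * t) :=
      (contDiff_const.mul Complex.ofRealCLM.contDiff).cexp
    exact ((contDiff_const.mul hexp).contDiffOn.mul hC).congr fun t ht => (hd t ht).deriv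

/-! ### Difference quotients along rotations -/

/-- The difference quotient of `f` along the rotation flow `z ↦ exp (I ε) z`. -/
noncomputable def rotationQuotient (f : ℂ → ℂ) (ε : ℝ) (z : ℂ) : ℂ :=
  (f (Complex.exp (Complex.I * ε) * z) - f z) / ε

/-- Mean value inequality for `u s - s * c`. -/
theorem norm_slope_sub_le {u u' : ℝ → ℂ} {ε η : ℝ} {c : ℂ} (hε : ε ≠ 0)
    (hu : ∀ s, |s| ≤ |ε| → HasDerivAt u (u' s) s) (hb : ∀ s, |s| ≤ |ε| → ‖u' s - c‖ ≤ η) :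
    ‖(u ε - u 0) / ε - c‖ ≤ η := by
  have hε' : (ε : ℂ) ≠ 0 := Complex.ofReal_ne_zero.2 hε
  have h := Convex.norm_image_sub_le_of_norm_hasDerivWithin_le (𝕜 := ℝ)
    (f := fun s => u s - s * c) (f' := fun s => u' s - c) (s := Icc (-|ε|) |ε|) (x := 0) (y := ε)
    (C := η)
    (fun s hs => by
      have h1 := (Complex.ofRealCLM.hasDerivAt (x := s)).mul_const c
      simp only [Complex.ofRealCLM_apply, Complex.ofReal_one, one_mul] at h1
      exact ((hu s (abs_le.2 hs)).sub h1).hasDerivWithinAt)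
    (fun s hs => hb s (abs_le.2 hs)) (convex_Icc _ _) (by simp) (abs_le.1 le_rfl)
  have h2 : (u ε - u 0) / ε - c = (u ε - ε * c - (u 0 - (0 : ℝ) * c)) / ε := by
    field_simp
    push_cast
    ring
  rw [h2, norm_div, Complex.norm_real, div_le_iff₀ (norm_pos_iff.2 hε)]
  simpa using h

theorem hasDerivAt_rotation {f : ℂ → ℂ} (hhol : DifferentiableOn ℂ f (ball (0 : ℂ) 1)) {z : ℂ}
    (hz : z ∈ ball (0 : ℂ) 1) (s : ℝ) :
    HasDerivAt (fun s : ℝ => f (Complex.exp (Complex.I * s) * z))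
      (Complex.I * (Complex.exp (Complex.I * s) * z) * deriv f (Complex.exp (Complex.I * s) * z))
      s := by
  have hw : Complex.exp (Complex.I * s) * z ∈ ball (0 : ℂ) 1 := by
    simpa using hz
  have hd := (hhol.differentiableAt (isOpen_ball.mem_nhds hw)).hasDerivAt
  have h := HasDerivAt.scomp s hd ((hasDerivAt_exp_I_mul s).mul_const z)
  simpa [Function.comp_def, mul_assoc] using h

/-- Closeness is joint in `(ε, z)`, so that compactness can later make it uniform in `z`. -/
theorem eventually_rotationQuotient_sub_le {f : ℂ → ℂ}
    (hhol : DifferentiableOn ℂ f (ball (0 : ℂ) 1)) {b : ℂ} (hb : b ∈ ball (0 : ℂ) 1) {η : ℝ}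
    (hη : 0 < η) :
    ∀ᶠ x : ℝ × ℂ in 𝓝 (0, b), x.1 ≠ 0 →
      ‖rotationQuotient f x.1 x.2 - Complex.I * b * deriv f b‖ ≤ η := by
  set φ : ℂ → ℂ := fun z => Complex.I * z * deriv f z with hφ
  have hφc : ContinuousAt φ b :=
    (continuousAt_const.mul continuousAt_id).mul
      ((hhol.deriv isOpen_ball).continuousOn.continuousAt (isOpen_ball.mem_nhds hb))
  have hT : Tendsto (fun x : ℝ × ℂ => Complex.exp (Complex.I * x.1) * x.2) (𝓝 (0, b)) (𝓝 b) := by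
    have : Continuous fun x : ℝ × ℂ => Complex.exp (Complex.I * x.1) * x.2 := by fun_prop
    simpa using this.tendsto (0, b)
  have h1 : ∀ᶠ x : ℝ × ℂ in 𝓝 (0, b),
      ‖φ (Complex.exp (Complex.I * x.1) * x.2) - φ b‖ < η := by
    have := (hφc.tendsto.comp hT).eventually (ball_mem_nhds _ hη)
    simpa [dist_eq_norm] using this
  have h2 : ∀ᶠ x : ℝ × ℂ in 𝓝 (0, b), x.2 ∈ ball (0 : ℂ) 1 :=
    continuous_snd.continuousAt.eventually (isOpen_ball.mem_nhds hb)
  obtain ⟨r, hr, h⟩ := Metric.eventually_nhds_iff.1 (h1.and h2)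
  refine Metric.eventually_nhds_iff.2 ⟨r, hr, ?_⟩
  rintro ⟨ε, z⟩ hx hε
  simp only [Prod.dist_eq, dist_zero_right, max_lt_iff, Real.norm_eq_abs] at hx
  have hmem : ∀ s : ℝ, |s| ≤ |ε| → dist (s, z) ((0 : ℝ), b) < r := fun s hs => by
    simp only [Prod.dist_eq, dist_zero_right, max_lt_iff, Real.norm_eq_abs]
    exact ⟨hs.trans_lt hx.1, hx.2⟩
  have hz := (h (hmem ε le_rfl)).2
  have := norm_slope_sub_le hε (fun s _ => hasDerivAt_rotation hhol hz s)
    (fun s hs => (h (hmem s hs)).1.le)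
  simpa [rotationQuotient] using this

/-- On the circle a rotation is a translation of `arg`, so the quotient is that of `g` at `arg z`,
and continuity of `g'` applies. -/
theorem eventually_rotationQuotient_sub_le_of_arc {f : ℂ → ℂ}
    (hg : ContDiffOn ℝ 1 (fun t : ℝ => f (Complex.exp (Complex.I * t))) (Ioo (0 : ℝ) 1))
    {t : ℝ} (ht : t ∈ Ioo (0 : ℝ) 1) {η : ℝ} (hη : 0 < η) :
    ∀ᶠ x : ℝ × ℂ in 𝓝 (0, Complex.exp (Complex.I * t)), x.1 ≠ 0 → ‖x.2‖ = 1 →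
      ‖rotationQuotient f x.1 x.2 -
        deriv (fun t : ℝ => f (Complex.exp (Complex.I * t))) t‖ ≤ η := by
  set g : ℝ → ℂ := fun t : ℝ => f (Complex.exp (Complex.I * t)) with hgdef
  have hgc : ContinuousAt (deriv g) t :=
    (hg.continuousOn_deriv_of_isOpen isOpen_Ioo le_rfl).continuousAt (isOpen_Ioo.mem_nhds ht)
  have hT : Tendsto (fun x : ℝ × ℂ => x.2.arg + x.1) (𝓝 (0, Complex.exp (Complex.I * t)))
      (𝓝 t) := by
    have h1 : Tendsto (fun x : ℝ × ℂ => x.2.arg) (𝓝 (0, Complex.exp (Complex.I * t))) (𝓝 t) := by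
      have := (continuousAt_arg_exp_I_mul ht).tendsto
      rw [arg_exp_I_mul ht] at this
      exact this.comp (continuous_snd.tendsto _)
    simpa using h1.add (continuous_fst.tendsto ((0 : ℝ), Complex.exp (Complex.I * t)))
  have h1 : ∀ᶠ x : ℝ × ℂ in 𝓝 (0, Complex.exp (Complex.I * t)),
      ‖deriv g (x.2.arg + x.1) - deriv g t‖ < η := by
    have := (hgc.tendsto.comp hT).eventually (ball_mem_nhds _ hη)
    simpa [dist_eq_norm] using this
  have h2 : ∀ᶠ x : ℝ × ℂ in 𝓝 (0, Complex.exp (Complex.I * t)), x.2.arg + x.1 ∈ Ioo (0 : ℝ) 1 :=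
    hT.eventually (isOpen_Ioo.mem_nhds ht)
  obtain ⟨r, hr, h⟩ := Metric.eventually_nhds_iff.1 (h1.and h2)
  refine Metric.eventually_nhds_iff.2 ⟨r, hr, ?_⟩
  rintro ⟨ε, z⟩ hx (hε : ε ≠ 0) (hz : ‖z‖ = 1)
  simp only [Prod.dist_eq, dist_zero_right, max_lt_iff, Real.norm_eq_abs] at hx
  have hmem : ∀ s : ℝ, |s| ≤ |ε| → dist (s, z) ((0 : ℝ), Complex.exp (Complex.I * t)) < r :=
    fun s hs => by
      simp only [Prod.dist_eq, dist_zero_right, max_lt_iff, Real.norm_eq_abs]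
      exact ⟨hs.trans_lt hx.1, hx.2⟩
  have hd : ∀ s : ℝ, |s| ≤ |ε| → HasDerivAt (fun s => g (z.arg + s)) (deriv g (z.arg + s)) s :=
    fun s hs => by
      have hm := (h (hmem s hs)).2
      have := ((hg.differentiableOn one_ne_zero).differentiableAt
        (isOpen_Ioo.mem_nhds hm)).hasDerivAt
      exact this.comp_const_add _ _
  have := norm_slope_sub_le hε hd (fun s hs => (h (hmem s hs)).1.le)
  have hrot : g (z.arg + ε) = f (Complex.exp (Complex.I * ε) * z) := by
    conv_rhs => rw [← exp_I_mul_arg hz, ← Complex.exp_add]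
    simp only [hgdef]
    congr 2
    push_cast
    ring
  have h0 : g z.arg = f z := by
    simp only [hgdef, exp_I_mul_arg hz]
  simpa [rotationQuotient, hrot, h0] using this

/-! ### The weight and the growth at the corners -/

/-- Up to the factor `z - z₀`, the polynomial agrees with `1 - ‖z‖²` on the circle of radius `δ`
around `z₀`. -/
theorem norm_weight_eq {z₀ z : ℂ} {δ : ℝ} (hz₀ : ‖z₀‖ = 1) (hz : ‖z - z₀‖ = δ) (hz1 : ‖z‖ ≤ 1) :
    ‖starRingEnd ℂ z₀ * (z - z₀) ^ 2 + (δ : ℂ) ^ 2 * z‖ = δ * (1 - ‖z‖ ^ 2) := by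
  have h1 : (1 : ℂ) = starRingEnd ℂ z₀ * z₀ := by
    rw [← Complex.normSq_eq_conj_mul_self, Complex.normSq_eq_norm_sq, hz₀]; simp
  have h2 : (δ : ℂ) ^ 2 = starRingEnd ℂ (z - z₀) * (z - z₀) := by
    rw [← Complex.normSq_eq_conj_mul_self, Complex.normSq_eq_norm_sq, hz]; simp
  have h3 : ((‖z‖ : ℂ)) ^ 2 = starRingEnd ℂ z * z := by
    rw [← Complex.normSq_eq_conj_mul_self, Complex.normSq_eq_norm_sq]; simp
  have h4 : starRingEnd ℂ z₀ * (z - z₀) ^ 2 + (δ : ℂ) ^ 2 * z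
      = -((z - z₀) * ((1 - ‖z‖ ^ 2 : ℝ) : ℂ)) := by
    push_cast
    rw [h3, h2, map_sub, h1]
    ring
  rw [h4, norm_neg, norm_mul, hz, Complex.norm_real, Real.norm_of_nonneg]
  nlinarith [norm_nonneg z]

section Bounds

variable {f : ℂ → ℂ} {z₀ : ℂ} {δ M : ℝ}

/-- Cauchy's estimate on the disk of radius `(1 - ‖z‖) / 2`. Since `1 - ‖z‖ ≤ ‖z - z₀‖ ≤ 2 * δ`,
that disk stays within `3 * δ` of `z₀`. -/
theorem norm_deriv_le_of_norm_le (hhol : DifferentiableOn ℂ f (ball (0 : ℂ) 1)) (hz₀ : ‖z₀‖ = 1)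
    (hM : ∀ z ∈ closedBall z₀ (4 * δ) ∩ closedBall 0 1, ‖f z‖ ≤ M) {z : ℂ} (hz : ‖z‖ < 1)
    (hd : ‖z - z₀‖ ≤ 2 * δ) : ‖deriv f z‖ ≤ M / ((1 - ‖z‖) / 2) := by
  have hle : 1 - ‖z‖ ≤ ‖z - z₀‖ := by
    have := norm_sub_norm_le z₀ z
    rw [hz₀, norm_sub_rev] at this
    exact this
  have hsub : closedBall z ((1 - ‖z‖) / 2) ⊆ ball 0 1 := by
    intro w hw
    rw [mem_closedBall, dist_eq_norm] at hw
    rw [mem_ball_zero_iff]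
    have := norm_sub_norm_le w z
    linarith
  refine Complex.norm_deriv_le_of_forall_mem_sphere_norm_le (by linarith)
    ((hhol.mono (closure_ball_subset_closedBall.trans hsub)).diffContOnCl) fun w hw => ?_
  refine hM w ⟨?_, ball_subset_closedBall (hsub (sphere_subset_closedBall hw))⟩
  rw [mem_sphere, dist_eq_norm] at hw
  rw [mem_closedBall, dist_eq_norm]
  have := norm_sub_le_norm_sub_add_norm_sub w z z₀
  linarith

theorem norm_rotation_sub_le {s : ℝ} {z : ℂ} (hz : ‖z‖ ≤ 1) :
    ‖Complex.exp (Complex.I * s) * z - z‖ ≤ |s| := by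
  have h : Complex.exp (Complex.I * s) * z - z = (Complex.exp (Complex.I * s) - 1) * z := by ring
  rw [h, norm_mul]
  have h1 : ‖Complex.exp (Complex.I * s) - 1‖ ≤ |s| := Real.norm_exp_I_mul_ofReal_sub_one_le
  nlinarith [norm_nonneg z, abs_nonneg s]

theorem norm_rotation_sub_center_le {s : ℝ} {z : ℂ} (hz : ‖z‖ ≤ 1) (hd : ‖z - z₀‖ ≤ δ)
    (hs : |s| ≤ δ) : ‖Complex.exp (Complex.I * s) * z - z₀‖ ≤ 2 * δ := by
  have h1 := norm_sub_le_norm_sub_add_norm_sub (Complex.exp (Complex.I * s) * z) z z₀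
  have h2 := norm_rotation_sub_le (s := s) hz
  linarith

theorem norm_rotationQuotient_le (hhol : DifferentiableOn ℂ f (ball (0 : ℂ) 1)) (hz₀ : ‖z₀‖ = 1)
    (hM : ∀ z ∈ closedBall z₀ (4 * δ) ∩ closedBall 0 1, ‖f z‖ ≤ M) {z : ℂ} (hz : ‖z‖ < 1)
    (hd : ‖z - z₀‖ ≤ δ) {ε : ℝ} (hε : ε ≠ 0) (hεδ : |ε| ≤ δ) :
    ‖rotationQuotient f ε z‖ ≤ M / ((1 - ‖z‖) / 2) := by
  have := norm_slope_sub_le (c := 0) (η := M / ((1 - ‖z‖) / 2)) hε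
    (fun s _ => hasDerivAt_rotation hhol (mem_ball_zero_iff.2 hz) s) fun s hs => by
      have hn : ‖Complex.exp (Complex.I * s) * z‖ = ‖z‖ := by simp
      have h := norm_deriv_le_of_norm_le hhol hz₀ hM (hn.trans_lt hz)
        (norm_rotation_sub_center_le hz.le hd (hs.trans hεδ))
      rw [hn] at h
      rw [sub_zero, norm_mul, norm_mul, hn, Complex.norm_I, one_mul]
      nlinarith [norm_nonneg z, norm_nonneg (deriv f (Complex.exp (Complex.I * s) * z))]
  simpa [rotationQuotient] using this

theorem continuousOn_rotationQuotient
    (hcont : ContinuousOn f (closedBall z₀ (4 * δ) ∩ closedBall 0 1)) (hδ : 0 < δ) {ε : ℝ} (hεδ : |ε| ≤ δ) :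
    ContinuousOn (rotationQuotient f ε) (closedBall z₀ δ ∩ closedBall 0 1) := by
  refine ((hcont.comp (by fun_prop) fun z hz => ?_).sub (hcont.mono ?_)).div_const _
  · rw [mem_inter_iff, mem_closedBall, mem_closedBall_zero_iff, dist_eq_norm] at hz
    refine ⟨?_, by simpa using hz.2⟩
    rw [mem_closedBall, dist_eq_norm]
    linarith [norm_rotation_sub_center_le hz.2 hz.1 hεδ]
  · exact inter_subset_inter_left _ (closedBall_subset_closedBall (by linarith))

theorem differentiableOn_rotationQuotient (hhol : DifferentiableOn ℂ f (ball (0 : ℂ) 1)) (ε : ℝ) :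
    DifferentiableOn ℂ (rotationQuotient f ε) (ball (0 : ℂ) 1) := by
  refine ((hhol.comp (by fun_prop) fun z hz => ?_).sub hhol).div_const _
  simpa using hz

/-- On the inner part of the boundary of the lens `ball z₀ δ ∩ ball 0 1`, the weighted difference
quotients are small near the corners. -/
theorem norm_weight_sq_mul_rotationQuotient_le (hhol : DifferentiableOn ℂ f (ball (0 : ℂ) 1))
    (hz₀ : ‖z₀‖ = 1) (hM : ∀ z ∈ closedBall z₀ (4 * δ) ∩ closedBall 0 1, ‖f z‖ ≤ M) {z : ℂ}
    (hz : ‖z‖ ≤ 1) (hd : ‖z - z₀‖ = δ) {ε : ℝ} (hε : ε ≠ 0) (hεδ : |ε| ≤ δ) :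
    ‖(starRingEnd ℂ z₀ * (z - z₀) ^ 2 + (δ : ℂ) ^ 2 * z) ^ 2 * rotationQuotient f ε z‖
      ≤ 8 * δ ^ 2 * M * (1 - ‖z‖) := by
  rw [norm_mul, norm_pow, norm_weight_eq hz₀ hd hz]
  rcases hz.lt_or_eq with h1 | h1
  · have hq := norm_rotationQuotient_le hhol hz₀ hM h1 hd.le hε hεδ
    have hpos : 0 < 1 - ‖z‖ := by linarith
    have hM0 : 0 ≤ M := by
      by_contra! hneg
      have : M / ((1 - ‖z‖) / 2) < 0 := div_neg_of_neg_of_pos hneg (by linarith)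
      linarith [norm_nonneg (rotationQuotient f ε z)]
    -- One factor of the squared weight cancels `1 / (1 - ‖z‖)`; the other still tends to zero at
    -- the corners.
    calc (δ * (1 - ‖z‖ ^ 2)) ^ 2 * ‖rotationQuotient f ε z‖
        ≤ (δ * (1 - ‖z‖ ^ 2)) ^ 2 * (M / ((1 - ‖z‖) / 2)) := by gcongr
      _ = 2 * δ ^ 2 * M * (1 - ‖z‖) * (1 + ‖z‖) ^ 2 := by field_simp; ring
      _ ≤ 2 * δ ^ 2 * M * (1 - ‖z‖) * 2 ^ 2 := by
          gcongr
          linarith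
      _ = 8 * δ ^ 2 * M * (1 - ‖z‖) := by ring
  · simp [h1]

end Bounds

/-! ### Uniform Cauchy estimates on the lens -/

section Lens

variable {f : ℂ → ℂ} {z₀ : ℂ} {δ M : ℝ}

/-- The weighted difference quotients along rotations are uniformly Cauchy on the frontier of the
lens `ball z₀ δ ∩ ball 0 1`. -/
theorem eventually_frontier_weighted_sub_le (hhol : DifferentiableOn ℂ f (ball (0 : ℂ) 1))
    (hg : ContDiffOn ℝ 1 (fun t : ℝ => f (Complex.exp (Complex.I * t))) (Ioo (0 : ℝ) 1))
    (hz₀ : ‖z₀‖ = 1) (hδ : 0 < δ) (hsub : closedBall z₀ (4 * δ) ∩ closedBall 0 1 ⊆ diskWithArc)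
    (hM : ∀ z ∈ closedBall z₀ (4 * δ) ∩ closedBall 0 1, ‖f z‖ ≤ M) {η : ℝ} (hη : 0 < η) :
    ∀ᶠ e : ℝ × ℝ in 𝓝 (0, 0), e.1 ≠ 0 → e.2 ≠ 0 →
      ∀ z ∈ frontier (ball z₀ δ ∩ ball (0 : ℂ) 1),
        ‖(starRingEnd ℂ z₀ * (z - z₀) ^ 2 + (δ : ℂ) ^ 2 * z) ^ 2 * rotationQuotient f e.1 z -
          (starRingEnd ℂ z₀ * (z - z₀) ^ 2 + (δ : ℂ) ^ 2 * z) ^ 2 * rotationQuotient f e.2 z‖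
          ≤ η := by
  set W : ℂ → ℂ := fun z => (starRingEnd ℂ z₀ * (z - z₀) ^ 2 + (δ : ℂ) ^ 2 * z) ^ 2 with hW
  have hWc : Continuous W := by fun_prop
  -- Local convergence to any constant `c` makes the weighted quotients locally Cauchy; `p`
  -- restricts `z` to the boundary piece at hand.
  have h₁ : ∀ {b c : ℂ} {p : ℂ → Prop}, (∀ η' > 0, ∀ᶠ x : ℝ × ℂ in 𝓝 (0, b), x.1 ≠ 0 →
      p x.2 → ‖rotationQuotient f x.1 x.2 - c‖ ≤ η') →
      ∀ᶠ x : (ℝ × ℝ) × ℂ in 𝓝 ((0, 0), b), x.1.1 ≠ 0 → x.1.2 ≠ 0 → p x.2 →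
        ‖W x.2 * rotationQuotient f x.1.1 x.2 - W x.2 * rotationQuotient f x.1.2 x.2‖ ≤ η := by
    intro b c p h
    have hpos : 0 < ‖W b‖ + 1 := by positivity
    have hη' : 0 < η / (2 * (‖W b‖ + 1)) := by positivity
    have t1 : Tendsto (fun x : (ℝ × ℝ) × ℂ => (x.1.1, x.2)) (𝓝 ((0, 0), b)) (𝓝 (0, b)) :=
      (show Continuous fun x : (ℝ × ℝ) × ℂ => (x.1.1, x.2) by fun_prop).tendsto _
    have t2 : Tendsto (fun x : (ℝ × ℝ) × ℂ => (x.1.2, x.2)) (𝓝 ((0, 0), b)) (𝓝 (0, b)) :=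
      (show Continuous fun x : (ℝ × ℝ) × ℂ => (x.1.2, x.2) by fun_prop).tendsto _
    have t3 : ∀ᶠ x : (ℝ × ℝ) × ℂ in 𝓝 ((0, 0), b), ‖W x.2‖ < ‖W b‖ + 1 :=
      (hWc.comp continuous_snd).norm.continuousAt.eventually (gt_mem_nhds (by simp))
    filter_upwards [t1.eventually (h _ hη'), t2.eventually (h _ hη'), t3]
      with x hx1 hx2 hx3 he1 he2 hp
    have e1 := hx1 he1 hp
    have e2 := hx2 he2 hp
    rw [norm_sub_rev] at e2
    have e3 := norm_sub_le_norm_sub_add_norm_sub (rotationQuotient f x.1.1 x.2) c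
      (rotationQuotient f x.1.2 x.2)
    rw [← mul_sub, norm_mul]
    calc ‖W x.2‖ * ‖rotationQuotient f x.1.1 x.2 - rotationQuotient f x.1.2 x.2‖
        ≤ (‖W b‖ + 1) * (η / (2 * (‖W b‖ + 1)) + η / (2 * (‖W b‖ + 1))) := by
          gcongr
          linarith
      _ = η := by field_simp; ring
  have hsub' : closedBall z₀ δ ∩ closedBall 0 1 ⊆ diskWithArc :=
    (inter_subset_inter_left _ (closedBall_subset_closedBall (by linarith))).trans hsub
  have houter : ∀ᶠ e : ℝ × ℝ in 𝓝 (0, 0), ∀ z ∈ closedBall z₀ δ ∩ sphere (0 : ℂ) 1,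
      e.1 ≠ 0 → e.2 ≠ 0 → ‖z‖ = 1 →
        ‖W z * rotationQuotient f e.1 z - W z * rotationQuotient f e.2 z‖ ≤ η := by
    refine ((isCompact_closedBall _ _).inter_right
      isClosed_sphere).eventually_forall_of_forall_eventually fun b hb => ?_
    have hbn : ‖b‖ = 1 := mem_sphere_zero_iff_norm.1 hb.2
    rcases hsub' ⟨hb.1, sphere_subset_closedBall hb.2⟩ with h | ⟨t, ht0, ht1, rfl⟩
    · exact absurd hbn (mem_ball_zero_iff.1 h).ne
    · exact h₁ (p := fun z => ‖z‖ = 1) fun η' hη' =>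
        eventually_rotationQuotient_sub_le_of_arc hg ⟨ht0, ht1⟩ hη'
  have hinner : ∀ᶠ e : ℝ × ℝ in 𝓝 (0, 0), ∀ z ∈ sphere z₀ δ ∩ closedBall (0 : ℂ) 1,
      e.1 ≠ 0 → e.2 ≠ 0 → ‖z‖ ≤ 1 ∧ ‖z - z₀‖ = δ →
        ‖W z * rotationQuotient f e.1 z - W z * rotationQuotient f e.2 z‖ ≤ η := by
    refine ((isCompact_sphere _ _).inter_right
      isClosed_closedBall).eventually_forall_of_forall_eventually fun b hb => ?_
    rcases (mem_closedBall_zero_iff.1 hb.2).lt_or_eq with hbn | hbn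
    · exact h₁ (p := fun z => ‖z‖ ≤ 1 ∧ ‖z - z₀‖ = δ) fun η' hη' =>
        (eventually_rotationQuotient_sub_le hhol (mem_ball_zero_iff.2 hbn) hη').mono
          fun x hx h1 _ => hx h1
    -- At a corner no limit is needed: each weighted quotient is itself below `η / 2` nearby.
    · have t1 : ∀ᶠ x : (ℝ × ℝ) × ℂ in 𝓝 ((0, 0), b), 8 * δ ^ 2 * M * (1 - ‖x.2‖) < η / 2 := by
        have hc : Continuous fun x : (ℝ × ℝ) × ℂ => 8 * δ ^ 2 * M * (1 - ‖x.2‖) := by fun_prop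
        exact hc.continuousAt.eventually (gt_mem_nhds (by simp [hbn, hη]))
      have t2 : ∀ᶠ x : (ℝ × ℝ) × ℂ in 𝓝 ((0, 0), b), |x.1.1| < δ := by
        have hc : Continuous fun x : (ℝ × ℝ) × ℂ => |x.1.1| := by fun_prop
        exact hc.continuousAt.eventually (gt_mem_nhds (by simp [hδ]))
      have t3 : ∀ᶠ x : (ℝ × ℝ) × ℂ in 𝓝 ((0, 0), b), |x.1.2| < δ := by
        have hc : Continuous fun x : (ℝ × ℝ) × ℂ => |x.1.2| := by fun_prop
        exact hc.continuousAt.eventually (gt_mem_nhds (by simp [hδ]))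
      filter_upwards [t1, t2, t3] with x h1 h2 h3 he1 he2 hz
      have e1 := norm_weight_sq_mul_rotationQuotient_le hhol hz₀ hM hz.1 hz.2 he1 h2.le
      have e2 := norm_weight_sq_mul_rotationQuotient_le hhol hz₀ hM hz.1 hz.2 he2 h3.le
      have e3 := norm_sub_le (W x.2 * rotationQuotient f x.1.1 x.2)
        (W x.2 * rotationQuotient f x.1.2 x.2)
      simp only [hW] at e3 ⊢
      linarith
  filter_upwards [houter, hinner] with e ho hi he1 he2 z hz
  have hzc : z ∈ closedBall z₀ δ ∩ closedBall (0 : ℂ) 1 :=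
    closure_minimal (inter_subset_inter ball_subset_closedBall ball_subset_closedBall)
      (isClosed_closedBall.inter isClosed_closedBall) (frontier_subset_closure hz)
  have hzU : z ∉ ball z₀ δ ∩ ball (0 : ℂ) 1 := by
    rw [(isOpen_ball.inter isOpen_ball).frontier_eq] at hz
    exact hz.2
  have hz1 : ‖z‖ ≤ 1 := mem_closedBall_zero_iff.1 hzc.2
  have hz2 : ‖z - z₀‖ ≤ δ := by simpa [dist_eq_norm] using hzc.1
  rcases hz1.lt_or_eq with h | h
  · have hz3 : ‖z - z₀‖ = δ := by
      refine hz2.antisymm (not_lt.1 fun hlt => hzU ⟨?_, mem_ball_zero_iff.2 h⟩)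
      simpa [dist_eq_norm] using hlt
    exact hi z ⟨by simpa [dist_eq_norm] using hz3, hzc.2⟩ he1 he2 ⟨hz1, hz3⟩
  · exact ho z ⟨hzc.1, mem_sphere_zero_iff_norm.2 h⟩ he1 he2 h

/-- The weighted difference quotients along rotations are uniformly Cauchy on the closed lens. -/
theorem eventually_closure_weighted_sub_le (hcont : ContinuousOn f diskWithArc)
    (hhol : DifferentiableOn ℂ f (ball (0 : ℂ) 1))
    (hg : ContDiffOn ℝ 1 (fun t : ℝ => f (Complex.exp (Complex.I * t))) (Ioo (0 : ℝ) 1))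
    (hz₀ : ‖z₀‖ = 1) (hδ : 0 < δ) (hsub : closedBall z₀ (4 * δ) ∩ closedBall 0 1 ⊆ diskWithArc)
    {η : ℝ} (hη : 0 < η) :
    ∀ᶠ e : ℝ × ℝ in 𝓝 (0, 0), e.1 ≠ 0 → e.2 ≠ 0 →
      ∀ z ∈ closure (ball z₀ δ ∩ ball (0 : ℂ) 1),
        ‖(starRingEnd ℂ z₀ * (z - z₀) ^ 2 + (δ : ℂ) ^ 2 * z) ^ 2 * rotationQuotient f e.1 z -
          (starRingEnd ℂ z₀ * (z - z₀) ^ 2 + (δ : ℂ) ^ 2 * z) ^ 2 * rotationQuotient f e.2 z‖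
          ≤ η := by
  have hcK := hcont.mono hsub
  obtain ⟨M, hM⟩ := ((isCompact_closedBall z₀ (4 * δ)).inter_right
    isClosed_closedBall).exists_bound_of_continuousOn hcK
  have t2 : ∀ᶠ e : ℝ × ℝ in 𝓝 (0, 0), |e.1| < δ :=
    continuous_fst.abs.continuousAt.eventually (gt_mem_nhds (by simp [hδ]))
  have t3 : ∀ᶠ e : ℝ × ℝ in 𝓝 (0, 0), |e.2| < δ :=
    continuous_snd.abs.continuousAt.eventually (gt_mem_nhds (by simp [hδ]))
  filter_upwards [eventually_frontier_weighted_sub_le hhol hg hz₀ hδ hsub hM hη, t2, t3]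
    with e he h2 h3 he1 he2 z hz
  have hdc : ∀ ε : ℝ, |ε| < δ → DiffContOnCl ℂ (fun z =>
      (starRingEnd ℂ z₀ * (z - z₀) ^ 2 + (δ : ℂ) ^ 2 * z) ^ 2 * rotationQuotient f ε z)
      (ball z₀ δ ∩ ball (0 : ℂ) 1) := fun ε hε => by
    have hW : Differentiable ℂ fun z : ℂ =>
        (starRingEnd ℂ z₀ * (z - z₀) ^ 2 + (δ : ℂ) ^ 2 * z) ^ 2 := by fun_prop
    refine ⟨hW.differentiableOn.mul
      ((differentiableOn_rotationQuotient hhol ε).mono inter_subset_right),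
      hW.continuous.continuousOn.mul ((continuousOn_rotationQuotient hcK hδ hε.le).mono ?_)⟩
    exact closure_minimal (inter_subset_inter ball_subset_closedBall ball_subset_closedBall)
      (isClosed_closedBall.inter isClosed_closedBall)
  exact Complex.norm_le_of_forall_mem_frontier_norm_le (isBounded_ball.subset inter_subset_left)
    ((hdc e.1 h2).sub (hdc e.2 h3)) (he he1 he2) hz

end Lens

/-! ### Limits of the derivative on the arc, and induction -/

/-- If the boundary function is `C¹` on the arc, then `f'` has a limit at each point of the arc. -/
theorem exists_tendsto_deriv {f : ℂ → ℂ} (hcont : ContinuousOn f diskWithArc)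
    (hhol : DifferentiableOn ℂ f (ball (0 : ℂ) 1))
    (hg : ContDiffOn ℝ 1 (fun t : ℝ => f (Complex.exp (Complex.I * t))) (Ioo (0 : ℝ) 1))
    {z₀ : ℂ} (hz₀ : z₀ ∈ openArc) :
    ∃ c, Tendsto (deriv f) (𝓝[ball (0 : ℂ) 1] z₀) (𝓝 c) := by
  obtain ⟨t, ht0, ht1, hzt⟩ := hz₀
  obtain ⟨r, hr, hsubr⟩ := exists_ball_inter_closedBall_subset ⟨ht0, ht1⟩
  rw [← hzt] at hsubr
  have hz₀ : ‖z₀‖ = 1 := by rw [hzt, norm_exp_I_mul]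
  obtain ⟨δ, hδ, hr'⟩ : ∃ δ > 0, r = 4 * δ := ⟨r / 4, by positivity, by ring⟩
  rw [hr'] at hsubr
  set W : ℂ → ℂ := fun z => (starRingEnd ℂ z₀ * (z - z₀) ^ 2 + (δ : ℂ) ^ 2 * z) ^ 2 with hW
  have hWc : Continuous W := by fun_prop
  have hz₀0 : z₀ ≠ 0 := norm_ne_zero_iff.1 (by simp [hz₀])
  have hWz₀ : W z₀ ≠ 0 := by simp [hW, hz₀0, hδ.ne']
  set c₀ := deriv (fun t : ℝ => f (Complex.exp (Complex.I * t))) t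
  have hlim : ∀ z ∈ ball (0 : ℂ) 1,
      Tendsto (fun ε => rotationQuotient f ε z) (𝓝[≠] 0) (𝓝 (Complex.I * z * deriv f z)) := by
    intro z hz
    refine Metric.tendsto_nhds.2 fun η hη => ?_
    have h := (show Continuous fun ε : ℝ => (ε, z) by fun_prop).tendsto 0 |>.eventually
      (eventually_rotationQuotient_sub_le hhol hz (half_pos hη))
    filter_upwards [nhdsWithin_le_nhds h, self_mem_nhdsWithin] with ε h1 h2
    rw [dist_eq_norm]
    linarith [h1 h2]
  have hlim₀ : Tendsto (fun ε => rotationQuotient f ε z₀) (𝓝[≠] 0) (𝓝 c₀) := by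
    refine Metric.tendsto_nhds.2 fun η hη => ?_
    have h := (show Continuous fun ε : ℝ => (ε, z₀) by fun_prop).tendsto 0 |>.eventually
      (hzt ▸ eventually_rotationQuotient_sub_le_of_arc hg ⟨ht0, ht1⟩ (half_pos hη))
    filter_upwards [nhdsWithin_le_nhds h, self_mem_nhdsWithin] with ε h1 h2
    rw [dist_eq_norm]
    linarith [h1 h2 hz₀]
  have hmain : Tendsto (fun z => W z * (Complex.I * z * deriv f z)) (𝓝[ball (0 : ℂ) 1] z₀)
      (𝓝 (W z₀ * c₀)) := by
    refine Metric.tendsto_nhds.2 fun η hη => ?_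
    have hη4 : 0 < η / 4 := by positivity
    have hev := eventually_closure_weighted_sub_le hcont hhol hg hz₀ hδ hsubr hη4
    obtain ⟨ρ, hρ, hball⟩ := Metric.eventually_nhds_iff.1 hev
    obtain ⟨ε, hε0, hε⟩ : ∃ ε : ℝ, 0 < ε ∧ ε < min ρ δ := exists_between (lt_min hρ hδ)
    have hερ : |ε| < ρ := by rw [abs_of_pos hε0]; exact hε.trans_le (min_le_left _ _)
    have hεδ : |ε| < δ := by rw [abs_of_pos hε0]; exact hε.trans_le (min_le_right _ _)
    -- The second parameter of the Cauchy estimate tends to zero while `ε` stays fixed.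
    have hpass : ∀ z ∈ closure (ball z₀ δ ∩ ball (0 : ℂ) 1), ∀ c,
        Tendsto (fun ε => rotationQuotient f ε z) (𝓝[≠] 0) (𝓝 c) →
        ‖W z * rotationQuotient f ε z - W z * c‖ ≤ η / 4 := by
      intro z hz c hc
      refine le_of_tendsto ((tendsto_const_nhds.sub (hc.const_mul (W z))).norm) ?_
      filter_upwards [self_mem_nhdsWithin, nhdsWithin_le_nhds (ball_mem_nhds (0 : ℝ) hρ)]
        with ε' h1 h2
      refine hball (y := (ε, ε')) ?_ hε0.ne' h1 z hz
      simp only [Prod.dist_eq, dist_zero_right, max_lt_iff, Real.norm_eq_abs]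
      exact ⟨hερ, by simpa using h2⟩
    have hz₀cl : z₀ ∈ closure (ball z₀ δ ∩ ball (0 : ℂ) 1) := by
      refine isOpen_ball.inter_closure ⟨mem_ball_self hδ, ?_⟩
      rw [closure_ball _ one_ne_zero]
      simp [hz₀]
    have hK : z₀ ∈ closedBall z₀ δ ∩ closedBall (0 : ℂ) 1 :=
      ⟨mem_closedBall_self hδ.le, by simp [hz₀]⟩
    have hq : ContinuousWithinAt (fun z => W z * rotationQuotient f ε z)
        (closedBall z₀ δ ∩ closedBall 0 1) z₀ :=
      hWc.continuousWithinAt.mul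
        (continuousOn_rotationQuotient (hcont.mono hsubr) hδ hεδ.le z₀ hK)
    have hnear : ball z₀ δ ∩ ball (0 : ℂ) 1 ∈ 𝓝[ball (0 : ℂ) 1] z₀ :=
      inter_mem (mem_nhdsWithin_of_mem_nhds (ball_mem_nhds _ hδ)) self_mem_nhdsWithin
    have hle : 𝓝[ball (0 : ℂ) 1] z₀ ≤ 𝓝[closedBall z₀ δ ∩ closedBall 0 1] z₀ :=
      nhdsWithin_le_of_mem (mem_of_superset hnear
        (inter_subset_inter ball_subset_closedBall ball_subset_closedBall))
    have hq' := (hq.tendsto.mono_left hle).eventually (ball_mem_nhds _ hη4)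
    filter_upwards [hnear, hq'] with z hz hzq
    have e1 := hpass z (subset_closure hz) _ (hlim z hz.2)
    have e2 := hpass z₀ hz₀cl _ hlim₀
    rw [← dist_eq_norm, dist_comm] at e1
    rw [← dist_eq_norm] at e2
    have := dist_triangle4 (W z * (Complex.I * z * deriv f z)) (W z * rotationQuotient f ε z)
      (W z₀ * rotationQuotient f ε z₀) (W z₀ * c₀)
    linarith
  have hden : Tendsto (fun z => W z * (Complex.I * z)) (𝓝[ball (0 : ℂ) 1] z₀)
      (𝓝 (W z₀ * (Complex.I * z₀))) :=
    ((hWc.mul (continuous_const.mul continuous_id)).tendsto z₀).mono_left nhdsWithin_le_nhds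
  have hne : W z₀ * (Complex.I * z₀) ≠ 0 :=
    mul_ne_zero hWz₀ (mul_ne_zero Complex.I_ne_zero hz₀0)
  -- The weight and `i z` are divided out; both are nonzero at `z₀`, where the weight is `(δ² z₀)²`.
  refine ⟨_, (hmain.div hden hne).congr' ?_⟩
  filter_upwards [hden.eventually_ne hne] with z hz
  simp only [Pi.div_apply]
  rw [div_eq_iff hz]
  ring

/-- A limit at each point suffices: extension by limits from a set to points of its closure is
automatically continuous. -/
theorem exists_isContExtension_deriv {f : ℂ → ℂ} (hcont : ContinuousOn f diskWithArc)
    (hhol : DifferentiableOn ℂ f (ball (0 : ℂ) 1))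
    (hg : ContDiffOn ℝ 1 (fun t : ℝ => f (Complex.exp (Complex.I * t))) (Ioo (0 : ℝ) 1)) :
    ∃ F, IsContExtension (deriv f) F := by
  have hin : ∀ z ∈ ball (0 : ℂ) 1, Tendsto (deriv f) (𝓝[ball (0 : ℂ) 1] z) (𝓝 (deriv f z)) :=
    (hhol.deriv isOpen_ball).continuousOn
  refine ⟨extendFrom (ball 0 1) (deriv f),
    continuousOn_extendFrom diskWithArc_subset_closure ?_,
    fun z hz => extendFrom_eq (subset_closure hz) (hin z hz)⟩
  rintro z (hz | hz)
  · exact ⟨_, hin z hz⟩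
  · exact exists_tendsto_deriv hcont hhol hg hz

theorem exists_isContExtension_iteratedDeriv {n : ℕ} : ∀ {f : ℂ → ℂ},
    ContinuousOn f diskWithArc → DifferentiableOn ℂ f (ball (0 : ℂ) 1) →
    ContDiffOn ℝ n (fun t : ℝ => f (Complex.exp (Complex.I * t))) (Ioo (0 : ℝ) 1) →
    ∃ F : ℂ → ℂ, IsContExtension (iteratedDeriv n f) F := by
  induction n with
  | zero => exact fun {f} hcont _ _ => ⟨f, hcont, by rw [iteratedDeriv_zero]; exact eqOn_refl _ _⟩
  | succ n ih =>
    intro f hcont hhol hg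
    push_cast at hg
    obtain ⟨F, hF⟩ := exists_isContExtension_deriv hcont hhol (hg.of_le le_add_self)
    have hd := fun t (ht : t ∈ Ioo (0 : ℝ) 1) => hasDerivAt_boundary hcont hhol hF ht
    have hg' := ((contDiffOn_succ_iff_deriv_of_isOpen isOpen_Ioo).1 hg).2.2
    have hexp : ContDiff ℝ n fun t : ℝ => (Complex.I * Complex.exp (Complex.I * t))⁻¹ :=
      (contDiff_const.mul (contDiff_const.mul Complex.ofRealCLM.contDiff).cexp).inv
        fun t => mul_ne_zero Complex.I_ne_zero (Complex.exp_ne_zero _)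
    -- The boundary function of `F` is `g' / (i e^{it})`, hence of class `C^n`.
    obtain ⟨G, hG⟩ := ih hF.1 (hF.differentiableOn hhol)
      ((hexp.contDiffOn.mul hg').congr fun t ht => by
        rw [(hd t ht).deriv, inv_mul_cancel_left₀
          (mul_ne_zero Complex.I_ne_zero (Complex.exp_ne_zero _))])
    exact ⟨G, hG.1, hG.2.trans (hF.iteratedDeriv_succ_eqOn n)⟩
end

theorem theorem3p7 (p : ℕ∞) (hp : 1 ≤ p) (f : ℂ → ℂ)
    (hcont : ContinuousOn f diskWithArc)
    (hhol : DifferentiableOn ℂ f (Metric.ball (0 : ℂ) 1)) :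
    ((∀ l : ℕ, (l : ℕ∞) ≤ p → ∃ F : ℂ → ℂ, IsContExtension (iteratedDeriv l f) F) ↔
      ContDiffOn ℝ (p : WithTop ℕ∞) (fun t : ℝ => f (Complex.exp (Complex.I * t)))
        (Ioo (0 : ℝ) 1)) ∧
    ((∀ l : ℕ, (l : ℕ∞) ≤ p → ∃ F : ℂ → ℂ, IsContExtension (iteratedDeriv l f) F) →
      ∀ F : ℂ → ℂ, IsContExtension (deriv f) F →
        ∀ t ∈ Ioo (0 : ℝ) 1,
          HasDerivAt (fun s : ℝ => f (Complex.exp (Complex.I * s)))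
            (Complex.I * Complex.exp (Complex.I * t) * F (Complex.exp (Complex.I * t))) t) := by
  refine ⟨⟨fun h => ?_, fun h l hl => ?_⟩, fun _ F hF t ht => hasDerivAt_boundary hcont hhol hF ht⟩
  · exact contDiffOn_iff_forall_nat_le.2 fun m hm =>
      contDiffOn_boundary hcont hhol fun l hl => h l ((Nat.cast_le.2 hl).trans hm)
  · exact exists_isContExtension_iteratedDeriv hcont hhol (contDiffOn_iff_forall_nat_le.1 h l hl)
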